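/- Let $D \ge 2$ be an integer and $\delta \in (0,1]$. Let $\mathcal{M} = \{\, |\psi\rangle\langle\psi| : |\psi\rangle \in \mathbb{C}^D,\ \langle\psi|\psi\rangle = 1 \,\}$ be the set of pure states in $\mathbb{C}^D$, equipped with the trace distance $d(\rho,\sigma) = \tfrac12 \|\rho-\sigma\|_1$, where $\|A\|_1 = \operatorname{Tr}\sqrt{A^\dagger A}$. Let $\mathcal{N}(\mathcal{M}, d, \delta)$ be the $\delta$-covering number of $(\mathcal{M}, d)$, i.e. the smallest cardinality of a $\delta$-net: a subset $C \subseteq \mathcal{M}$ such that every $\rho \in \mathcal{M}$ satisfies $d(\rho,\sigma) \le \delta$ for some $\sigma \in C$. Then $\mathcal{N}(\mathcal{M}, d, \delta)$ is finite and $$\left(\frac1\delta\right)^{2(D-1)} \;\le\; \mathcal{N}(\mathcal{M}, d, \delta) \;\le\; 5\, D \ln(D) \left(\frac1\delta\right)^{2(D-1)}.$$ -/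

import Mathlib

open scoped MatrixOrder ComplexOrder NNReal

noncomputable section

/-- The trace norm `‖A‖₁ = Tr √(A† A)` of a complex square matrix. The trace of the positive
semidefinite matrix `√(A† A)` is a nonnegative real number, so taking its real part loses
nothing. -/
def traceNorm {D : ℕ} (A : Matrix (Fin D) (Fin D) ℂ) : ℝ :=
  (CFC.sqrt (A.conjTranspose * A)).trace.re

/-- The trace distance `d(ρ, σ) = ½ ‖ρ - σ‖₁`. -/
def traceDist {D : ℕ} (ρ σ : Matrix (Fin D) (Fin D) ℂ) : ℝ :=
  (1 / 2) * traceNorm (ρ - σ)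

/-- A matrix is a pure state if it is `|ψ⟩⟨ψ|` for some unit vector `ψ` in `ℂ^D`. -/
def IsPureState {D : ℕ} (ρ : Matrix (Fin D) (Fin D) ℂ) : Prop :=
  ∃ ψ : EuclideanSpace ℂ (Fin D), ‖ψ‖ = 1 ∧ ρ = Matrix.vecMulVec ψ.ofLp (star ψ.ofLp)

/-- The space `{|ψ⟩⟨ψ| : ψ ∈ ℂ^D, ⟨ψ|ψ⟩ = 1}` of pure states. -/
@[ext]
structure PureState (D : ℕ) where
  /-- the density matrix of the state -/
  toMatrix : Matrix (Fin D) (Fin D) ℂ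
  isPure : IsPureState toMatrix

theorem traceNorm_of_cube {D : ℕ} {A : Matrix (Fin D) (Fin D) ℂ} {s : ℝ} (hA : A.IsHermitian)
    (h3 : A * A * A = (s : ℂ) • A) (ht : (A * A).trace = 2 * s) :
    traceNorm A = Real.sqrt (2 * (A.conjTranspose * A).trace.re) := by
  have hp : (A.conjTranspose * A).PosSemidef := Matrix.posSemidef_conjTranspose_mul_self A
  have hs : 0 ≤ s := by
    have h := hp.trace_nonneg
    rw [hA.eq, ht] at h
    have h' := (Complex.le_def.1 h).1
    simp at h'
    linarith
  rcases hs.eq_or_lt with rfl | hs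
  · have h0 : A.conjTranspose * A = 0 := by
      rw [← hp.trace_eq_zero_iff, hA.eq, ht]
      simp
    simp [traceNorm, h0]
  · have hr : 0 < Real.sqrt s := Real.sqrt_pos.2 hs
    have hsq : Real.sqrt s * Real.sqrt s = s := Real.mul_self_sqrt hs.le
    have key : CFC.sqrt (A.conjTranspose * A) =
        (Real.sqrt s)⁻¹ • (A.conjTranspose * A) := by
      apply CFC.sqrt_unique
      · rw [hA.eq]
        have h4 : A * A * (A * A) = s • (A * A) := by
          rw [← Matrix.mul_assoc, h3]
          ext i j
          simp
        rw [Matrix.smul_mul, Matrix.mul_smul, h4, smul_smul, smul_smul]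
        have : (Real.sqrt s)⁻¹ * (Real.sqrt s)⁻¹ * s = 1 := by
          nth_rewrite 3 [← hsq]
          field_simp
        rw [this, one_smul]
      · exact (hp.smul (inv_nonneg.2 hr.le)).nonneg
    rw [traceNorm, key, Matrix.trace_smul, hA.eq, ht]
    have e1 : ((2 : ℂ) * s).re = 2 * s := by simp
    rw [Complex.smul_re, e1, smul_eq_mul, eq_comm, Real.sqrt_eq_iff_mul_self_eq (by positivity)
      (by positivity)]
    field_simp
    rw [pow_two, hsq]

theorem traceNorm_sub_vecMulVec {D : ℕ} {u v : Fin D → ℂ} (h1 : star u ⬝ᵥ u = 1)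
    (h2 : star v ⬝ᵥ v = 1) :
    traceNorm (Matrix.vecMulVec u (star u) - Matrix.vecMulVec v (star v)) =
      Real.sqrt (2 * ((Matrix.vecMulVec u (star u) - Matrix.vecMulVec v (star v)).conjTranspose *
        (Matrix.vecMulVec u (star u) - Matrix.vecMulVec v (star v))).trace.re) := by
  have h3 : star v ⬝ᵥ u = star (star u ⬝ᵥ v) := by
    rw [Matrix.star_dotProduct, dotProduct_comm]
  set c : ℂ := star u ⬝ᵥ v with hc
  have hm : ∀ a b x y : Fin D → ℂ, Matrix.vecMulVec a b * Matrix.vecMulVec x y =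
      (b ⬝ᵥ x) • Matrix.vecMulVec a y := by
    intro a b x y
    rw [Matrix.vecMulVec_mul_vecMulVec]
    ext i j
    simp [Matrix.vecMulVec_apply]
    try ring
  have hs : ((1 - Complex.normSq c : ℝ) : ℂ) = 1 - star c * c := by
    rw [Complex.ofReal_sub, Complex.ofReal_one, Complex.normSq_eq_conj_mul_self]
    rfl
  apply traceNorm_of_cube (s := 1 - Complex.normSq c)
  · simp [Matrix.IsHermitian, Matrix.conjTranspose_vecMulVec]
  · rw [hs]
    simp only [Matrix.sub_mul, Matrix.mul_sub, hm, Matrix.smul_mul, smul_smul, h1, h2, h3, ← hc]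
    module
  · rw [hs]
    simp only [Matrix.sub_mul, Matrix.mul_sub, hm, Matrix.trace_sub, Matrix.trace_smul,
      Matrix.trace_vecMulVec, dotProduct_comm _ (star _), h1, h2, h3, ← hc, smul_eq_mul]
    ring

/-- On differences of pure states, the trace norm is `√2` times the Frobenius norm. -/
theorem traceNorm_sub_pure {D : ℕ} {ρ σ : Matrix (Fin D) (Fin D) ℂ}
    (hρ : IsPureState ρ) (hσ : IsPureState σ) :
    traceNorm (ρ - σ) = Real.sqrt (2 * ((ρ - σ).conjTranspose * (ρ - σ)).trace.re) := by
  obtain ⟨ψ, hψ, rfl⟩ := hρ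
  obtain ⟨φ, hφ, rfl⟩ := hσ
  have unit : ∀ v : EuclideanSpace ℂ (Fin D), ‖v‖ = 1 → star v.ofLp ⬝ᵥ v.ofLp = 1 := by
    intro v hv
    have := EuclideanSpace.inner_eq_star_dotProduct v v
    rw [inner_self_eq_norm_sq_to_K, hv] at this
    rw [dotProduct_comm, ← this]
    simp
  exact traceNorm_sub_vecMulVec (unit ψ hψ) (unit φ hφ)

attribute [local instance] Matrix.frobeniusNormedAddCommGroup in
theorem frobenius_sq {D : ℕ} (A : Matrix (Fin D) (Fin D) ℂ) :
    (A.conjTranspose * A).trace.re = ‖A‖ ^ 2 := by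
  rw [Matrix.frobenius_norm_def, ← Real.sqrt_eq_rpow, Real.sq_sqrt (by positivity)]
  simp only [Matrix.trace, Matrix.diag, Matrix.mul_apply, Matrix.conjTranspose_apply,
    Complex.re_sum]
  rw [Finset.sum_comm]
  refine Finset.sum_congr rfl fun i _ => Finset.sum_congr rfl fun j _ => ?_
  rw [Real.rpow_two, ← Complex.normSq_eq_norm_sq, Complex.normSq_apply]
  simp

attribute [local instance] Matrix.frobeniusNormedAddCommGroup in
theorem traceDist_eq_frobenius {D : ℕ} (ρ σ : PureState D) :
    traceDist ρ.toMatrix σ.toMatrix = (Real.sqrt 2 / 2) * ‖ρ.toMatrix - σ.toMatrix‖ := by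
  rw [traceDist, traceNorm_sub_pure ρ.isPure σ.isPure, frobenius_sq,
    Real.sqrt_mul (by norm_num), Real.sqrt_sq (norm_nonneg _)]
  ring

/-- The set of pure states as a metric space under the trace distance. -/
instance {D : ℕ} : MetricSpace (PureState D) where
  dist ρ σ := traceDist ρ.toMatrix σ.toMatrix
  dist_self ρ := by simp [traceDist, traceNorm]
  dist_comm ρ σ := by
    rw [traceDist_eq_frobenius, traceDist_eq_frobenius,
      @norm_sub_rev _ Matrix.frobeniusNormedAddCommGroup.toSeminormedAddCommGroup.toSeminormedAddGroup]
  dist_triangle ρ σ τ := by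
    let _ := Matrix.frobeniusNormedAddCommGroup (m := Fin D) (n := Fin D) (α := ℂ)
    simp only [traceDist_eq_frobenius]
    rw [← mul_add]
    exact mul_le_mul_of_nonneg_left (norm_sub_le_norm_sub_add_norm_sub _ _ _) (by positivity)
  eq_of_dist_eq_zero {ρ σ} h := by
    let _ := Matrix.frobeniusNormedAddCommGroup (m := Fin D) (n := Fin D) (α := ℂ)
    rw [traceDist_eq_frobenius] at h
    have h2 : Real.sqrt 2 / 2 ≠ 0 := by positivity
    have := (mul_eq_zero.1 h).resolve_left h2
    exact PureState.ext (sub_eq_zero.1 (norm_eq_zero.1 this))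

end

/-!
A pure state is a line in `ℂ^D`, and `d(ψ, φ) = √(1 - |⟨ψ, φ⟩|²)` (`PureState.dist_ofUnit`). Put
`n = D - 1`. The space of pure states carries a unitarily invariant probability measure, realised
here as the image of a Gaussian measure on `ℂ^D` under `z ↦ |z⟩⟨z| / ‖z‖²`, and for this measure a
ball of radius `r ≤ 1` has mass exactly `r ^ (2 n)` (`complexGaussian_preimage_closedBall`): with
coordinates `(a, w) ∈ ℂ × ℂⁿ` adapted to the centre, the ball is the cone
`(r⁻² - 1) ‖w‖² ≤ |a|²`; since `|a|²` has an exponential tail, integrating out `a` replaces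
`exp (-‖w‖²)` by `exp (-r⁻² ‖w‖²)`, and scaling `w` gives the factor `r ^ (2 n)`.

The lower bound is then the union bound. For the upper bound, choose `k` centres greedily, each
ball of radius `(1 - t) δ` catching at least its average share of what is still uncovered, which
leaves mass at most `(1 - ((1 - t) δ) ^ (2 n)) ^ k`. Completing the net by a maximal `δ`-separated
set of points at distance more than `δ` from all centres costs at most this mass divided by
`(t δ) ^ (2 n)`, because the `t δ`-balls about the added points are disjoint and still uncovered
(`coveringNumber_le_of_measure_closedBall`).

For `D = 2, 3` take `k = 0` and `t = 1 / 2`, which gives the factor `4 ^ n ≤ 5 D log D`. For `D ≥ 4`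
take `t = 1 / (8 n)` and `k ≈ (8 / 3) n log (8 n - 1) δ ^ (-2 n)`, which gives the factor
`(8 / 3) n log (8 n - 1) + 7 / 3`; that this is at most `5 D log D` is `log_bound_three` for `D = 4`
and `log_bound_of_four_le` for larger `D`.
-/

noncomputable section

open MeasureTheory ENNReal

/-! ### Covering numbers of spaces with a homogeneous probability measure -/

theorem measurableSet_preimage_closedBall {X Ω : Type*} [PseudoMetricSpace X] [MeasurableSpace Ω]
    {f : Ω → X} (hd : Measurable fun p : Ω × Ω => dist (f p.1) (f p.2))
    (hf : Function.Surjective f) (x : X) (r : ℝ) :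
    MeasurableSet (f ⁻¹' Metric.closedBall x r) := by
  obtain ⟨ω, rfl⟩ := hf x
  exact (measurableSet_le hd (measurable_const (a := r))).preimage (f := fun y => (y, ω))
    (by fun_prop)

/-- Some ball of radius `r` catches at least its fair share of a given set `U`: averaging
`μ (U ∩ B(x, r))` over the centre `x` gives `b * μ U` by Tonelli, `b` being the common measure of
all balls of radius `r`. -/
theorem exists_measure_diff_closedBall_le {X Ω : Type*} [PseudoMetricSpace X] [MeasurableSpace Ω]
    {μ : Measure Ω} [IsProbabilityMeasure μ] {f : Ω → X}
    (hd : Measurable fun p : Ω × Ω => dist (f p.1) (f p.2)) (hf : Function.Surjective f)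
    {r : ℝ} {b : ℝ≥0∞} (hb : ∀ x, μ (f ⁻¹' Metric.closedBall x r) = b)
    (U : Set Ω) :
    ∃ x, μ (U \ f ⁻¹' Metric.closedBall x r) ≤ (1 - b) * μ U := by
  have hball := fun ω => measurableSet_preimage_closedBall hd hf (f ω) r
  have hS : MeasurableSet {p : Ω × Ω | dist (f p.2) (f p.1) ≤ r} :=
    (measurableSet_le hd (measurable_const (a := r))).preimage measurable_swap
  have key : ∫⁻ ω, μ (U ∩ f ⁻¹' Metric.closedBall (f ω) r) ∂μ = b * μ U := by
    have h1 : ∀ ω, μ (U ∩ f ⁻¹' Metric.closedBall (f ω) r) =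
        ∫⁻ y in U, {p : Ω × Ω | dist (f p.2) (f p.1) ≤ r}.indicator 1 (ω, y) ∂μ := by
      intro ω
      rw [Set.inter_comm, ← Measure.restrict_apply (hball ω), ← lintegral_indicator_one (hball ω)]
      rfl
    simp_rw [h1]
    rw [lintegral_lintegral_swap]
    · rw [← setLIntegral_const]
      refine lintegral_congr fun y => ?_
      rw [← hb (f y), ← lintegral_indicator_one (hball y)]
      refine lintegral_congr fun ω => ?_
      simp only [Set.indicator_apply, Set.mem_ofPred_eq, dist_comm (f y)]
      rfl
    · exact (measurable_one.indicator hS).aemeasurable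
  have hb1 : b ≠ ∞ := by
    obtain ⟨ω⟩ := nonempty_of_isProbabilityMeasure μ
    exact hb (f ω) ▸ measure_ne_top _ _
  obtain ⟨ω, hω⟩ := exists_lintegral_le (μ := μ)
    (f := fun ω => μ (U ∩ f ⁻¹' Metric.closedBall (f ω) r))
    (by rw [key]; exact ENNReal.mul_ne_top hb1 (measure_ne_top _ _))
  refine ⟨f ω, ?_⟩
  rw [key] at hω
  rw [ENNReal.sub_mul (fun _ _ => measure_ne_top _ _), one_mul]
  refine ENNReal.le_sub_of_add_le_right (ENNReal.mul_ne_top hb1 (measure_ne_top _ _)) ?_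
  calc μ (U \ f ⁻¹' Metric.closedBall (f ω) r) + b * μ U
      ≤ μ (U \ f ⁻¹' Metric.closedBall (f ω) r) + μ (U ∩ f ⁻¹' Metric.closedBall (f ω) r) := by
        gcongr
    _ = μ U := by rw [add_comm, measure_inter_add_sdiff U (hball ω)]

/-- Greedy covering: `k` balls of common measure `b`, chosen one after the other, can be made to
leave out at most `(1 - b) ^ k`. -/
theorem exists_finset_measure_uncovered_le {X Ω : Type*} [PseudoMetricSpace X] [MeasurableSpace Ω]
    {μ : Measure Ω} [IsProbabilityMeasure μ] {f : Ω → X}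
    (hd : Measurable fun p : Ω × Ω => dist (f p.1) (f p.2)) (hf : Function.Surjective f)
    {r : ℝ} {b : ℝ≥0∞} (hb : ∀ x, μ (f ⁻¹' Metric.closedBall x r) = b) (k : ℕ) :
    ∃ T : Finset X, T.card ≤ k ∧ μ {ω | ∀ x ∈ T, r < dist (f ω) x} ≤ (1 - b) ^ k := by
  classical
  induction k with
  | zero => exact ⟨∅, by simp⟩
  | succ k ih =>
    obtain ⟨T, hT, hμ⟩ := ih
    obtain ⟨x, hx⟩ := exists_measure_diff_closedBall_le hd hf hb {ω | ∀ x ∈ T, r < dist (f ω) x}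
    have hset : {ω | ∀ y ∈ insert x T, r < dist (f ω) y} =
        {ω | ∀ y ∈ T, r < dist (f ω) y} \ f ⁻¹' Metric.closedBall x r := by
      ext ω
      simp [and_comm]
    refine ⟨insert x T, (Finset.card_insert_le _ _).trans (by omega), ?_⟩
    rw [hset, pow_succ']
    exact hx.trans (by gcongr)

/-- If balls of radius `r` around the points of `T` leave out a set of measure `u`, then adding
a maximal `δ`-separated set of points at distance more than `δ` from `T` gives a `δ`-net: the balls
of radius `s` around the added points are disjoint and left out by the balls of radius
`r ≤ δ - s`. -/
theorem coveringNumber_le_card_add {X Ω : Type*} [PseudoMetricSpace X] [MeasurableSpace Ω]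
    {μ : Measure Ω} {f : Ω → X}
    (hd : Measurable fun p : Ω × Ω => dist (f p.1) (f p.2)) (hf : Function.Surjective f)
    {δ : ℝ≥0} {r s : ℝ} (hrs : r + s ≤ δ) (hs : 2 * s ≤ δ) {c : ℝ≥0∞} (hc0 : c ≠ 0) (hc : c ≠ ∞)
    (hsc : ∀ x, μ (f ⁻¹' Metric.closedBall x s) = c) (T : Finset X) :
    ((Metric.coveringNumber δ (Set.univ : Set X) : ℕ∞) : ℝ≥0∞) ≤
      T.card + μ {ω | ∀ x ∈ T, r < dist (f ω) x} / c := by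
  obtain ⟨S, hS⟩ := zorn_subset {S : Set X | S ⊆ {x | ∀ y ∈ T, δ < dist x y} ∧
      Metric.IsSeparated δ S} (by
    intro 𝒞 h𝒞 hchain
    refine ⟨⋃₀ 𝒞, ⟨Set.sUnion_subset fun S hS => (h𝒞 hS).1, ?_⟩, fun S hS =>
      Set.subset_sUnion_of_mem hS⟩
    exact (Set.pairwise_sUnion hchain.directedOn).2 fun S hS => (h𝒞 hS).2)
  have hcov := Metric.IsCover.of_maximal_isSeparated hS
  obtain ⟨hSW, hSsep⟩ := hS.prop
  have hcov' : Metric.IsCover δ (Set.univ : Set X) ((T : Set X) ∪ S) := by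
    intro x _
    by_cases hx : ∀ y ∈ T, (δ : ℝ) < dist x y
    · obtain ⟨y, hy, hxy⟩ := hcov hx
      exact ⟨y, Or.inr hy, hxy⟩
    · push Not at hx
      obtain ⟨y, hy, hxy⟩ := hx
      refine ⟨y, Or.inl hy, ?_⟩
      change edist x y ≤ δ
      rw [edist_nndist, ENNReal.coe_le_coe]
      exact hxy
  have hcard : S.encard * c ≤ μ {ω | ∀ x ∈ T, r < dist (f ω) x} := by
    rw [← ENNReal.tsum_set_const]
    calc ∑' _ : S, c = ∑' x : S, μ (f ⁻¹' Metric.closedBall (x : X) s) := by simp [hsc]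
      _ ≤ μ (⋃ x : S, f ⁻¹' Metric.closedBall (x : X) s) := by
        refine tsum_meas_le_meas_iUnion_of_disjoint μ
          (fun x => measurableSet_preimage_closedBall hd hf x s) fun x y hxy => ?_
        refine Disjoint.preimage f (Set.disjoint_left.2 fun z hzx hzy => ?_)
        have h1 : (δ : ℝ) < dist (x : X) y := by
          have := hSsep x.2 y.2 (Subtype.coe_ne_coe.2 hxy)
          simp only [edist_nndist, ENNReal.coe_lt_coe] at this
          exact this
        have h2 := dist_triangle_left (x : X) y z
        rw [Metric.mem_closedBall] at hzx hzy
        linarith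
      _ ≤ _ := by
        refine measure_mono (Set.iUnion_subset fun x ω hω y hy => ?_)
        have h1 := hSW x.2 y hy
        have h2 := dist_triangle_left (x : X) y (f ω)
        rw [Set.mem_preimage, Metric.mem_closedBall] at hω
        linarith
  calc ((Metric.coveringNumber δ (Set.univ : Set X) : ℕ∞) : ℝ≥0∞)
      ≤ (((T : Set X) ∪ S).encard : ℕ∞) :=
        ENat.toENNReal_le.2 (hcov'.coveringNumber_le_encard (Set.subset_univ _))
    _ ≤ ((T : Set X).encard + S.encard : ℕ∞) := ENat.toENNReal_le.2 (Set.encard_union_le _ _)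
    _ = T.card + S.encard := by simp
    _ ≤ _ := by
      gcongr
      exact (ENNReal.le_div_iff_mul_le (Or.inl hc0) (Or.inl hc)).2 hcard

theorem coveringNumber_le_of_measure_closedBall {X Ω : Type*} [PseudoMetricSpace X]
    [MeasurableSpace Ω] {μ : Measure Ω} [IsProbabilityMeasure μ] {f : Ω → X}
    (hd : Measurable fun p : Ω × Ω => dist (f p.1) (f p.2)) (hf : Function.Surjective f)
    {δ : ℝ≥0} {r s : ℝ} (hrs : r + s ≤ δ) (hs : 2 * s ≤ δ) {b c : ℝ≥0∞} (hc0 : c ≠ 0) (hc : c ≠ ∞)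
    (hrb : ∀ x, μ (f ⁻¹' Metric.closedBall x r) = b)
    (hsc : ∀ x, μ (f ⁻¹' Metric.closedBall x s) = c) (k : ℕ) :
    ((Metric.coveringNumber δ (Set.univ : Set X) : ℕ∞) : ℝ≥0∞) ≤ k + (1 - b) ^ k / c := by
  obtain ⟨T, hT, hμ⟩ := exists_finset_measure_uncovered_le hd hf hrb k
  refine (coveringNumber_le_card_add hd hf hrs hs hc0 hc hsc T).trans ?_
  gcongr

/-- The union bound: the balls about a minimal net cover a space of measure `1`. -/
theorem one_le_coveringNumber_mul {X Ω : Type*} [PseudoMetricSpace X]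
    [MeasurableSpace Ω] {μ : Measure Ω} [IsProbabilityMeasure μ] {f : Ω → X}
    {δ : ℝ≥0} {b : ℝ≥0∞} (hb : ∀ x, μ (f ⁻¹' Metric.closedBall x δ) = b)
    (hfin : Metric.coveringNumber δ (Set.univ : Set X) ≠ ⊤) :
    1 ≤ ((Metric.coveringNumber δ (Set.univ : Set X) : ℕ∞) : ℝ≥0∞) * b := by
  obtain ⟨C, -, hCfin, hC, hcard⟩ := Metric.exists_set_encard_eq_coveringNumber hfin
  have := hCfin.countable.to_subtype
  rw [← hcard, ← ENNReal.tsum_set_const, ← measure_univ (μ := μ)]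
  calc μ Set.univ ≤ μ (⋃ x : C, f ⁻¹' Metric.closedBall (x : X) δ) := by
        refine measure_mono fun ω _ => ?_
        obtain ⟨y, hy, hxy⟩ := hC (Set.mem_univ (f ω))
        refine Set.mem_iUnion.2 ⟨⟨y, hy⟩, ?_⟩
        change edist (f ω) y ≤ δ at hxy
        rw [edist_nndist, ENNReal.coe_le_coe] at hxy
        exact hxy
    _ ≤ ∑' x : C, μ (f ⁻¹' Metric.closedBall (x : X) δ) := measure_iUnion_le _
    _ = ∑' _ : C, b := by simp [hb]

/-! ### Gaussian measure of complex cones -/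

theorem lintegral_exp_neg_mul_norm_sq {V : Type*} [NormedAddCommGroup V] [InnerProductSpace ℝ V]
    [FiniteDimensional ℝ V] [MeasurableSpace V] [BorelSpace V] {b : ℝ} (hb : 0 < b) :
    ∫⁻ v : V, ENNReal.ofReal (Real.exp (-b * ‖v‖ ^ 2)) =
      ENNReal.ofReal ((Real.pi / b) ^ (Module.finrank ℝ V / 2 : ℝ)) := by
  have h := GaussianFourier.integral_rexp_neg_mul_sq_norm (V := V) hb
  rw [← h, ofReal_integral_eq_lintegral_ofReal]
  · refine Integrable.of_integral_ne_zero ?_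
    rw [h]
    have := Real.pi_pos
    positivity
  · exact Filter.Eventually.of_forall fun v => (Real.exp_pos _).le

theorem finrank_real_euclideanSpace_complex (n : ℕ) :
    Module.finrank ℝ (EuclideanSpace ℂ (Fin n)) = 2 * n := by
  rw [finrank_real_of_complex, finrank_euclideanSpace_fin]

theorem lintegral_exp_neg_mul_norm_sq_euclideanSpace {n : ℕ} {b : ℝ} (hb : 0 < b) :
    ∫⁻ v : EuclideanSpace ℂ (Fin n), ENNReal.ofReal (Real.exp (-b * ‖v‖ ^ 2)) =
      ENNReal.ofReal ((Real.pi / b) ^ n) := by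
  rw [lintegral_exp_neg_mul_norm_sq hb, finrank_real_euclideanSpace_complex]
  congr 1
  push_cast
  rw [mul_div_cancel_left₀ _ two_ne_zero, Real.rpow_natCast]

theorem integral_Ioi_mul_exp_neg_sq {a : ℝ} (ha : 0 ≤ a) :
    ∫ y in Set.Ioi a, y * Real.exp (-y ^ 2) = Real.exp (-a ^ 2) / 2 := by
  have hderiv : ∀ x : ℝ,
      HasDerivAt (fun y => -(Real.exp (-y ^ 2) / 2)) (x * Real.exp (-x ^ 2)) x := by
    intro x
    refine (((hasDerivAt_pow 2 x).neg.exp).div_const 2).neg.congr_deriv ?_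
    simp only [Pi.neg_apply]
    ring
  have htends :
      Filter.Tendsto (fun y : ℝ => -(Real.exp (-y ^ 2) / 2)) Filter.atTop (nhds (-(0 / 2))) :=
    ((Real.tendsto_exp_neg_atTop_nhds_zero.comp
      (Filter.tendsto_pow_atTop two_ne_zero)).div_const 2).neg
  rw [integral_Ioi_of_hasDerivAt_of_nonneg (hderiv a).continuousAt.continuousWithinAt
    (fun x _ => hderiv x) (fun x hx => mul_nonneg (ha.trans (le_of_lt hx)) (Real.exp_pos _).le) htends]
  ring

/-- The squared modulus of a Gaussian variable in `ℂ` has an exponential tail. -/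
theorem lintegral_exp_neg_norm_sq_tail {t : ℝ} (ht : 0 ≤ t) :
    ∫⁻ a : ℂ in {a | t ≤ ‖a‖ ^ 2}, ENNReal.ofReal (Real.exp (-‖a‖ ^ 2)) =
      ENNReal.ofReal (Real.pi * Real.exp (-t)) := by
  have hm : MeasurableSet {a : ℂ | t ≤ ‖a‖ ^ 2} :=
    measurableSet_le measurable_const (by fun_prop)
  have hint : Integrable fun a : ℂ => Real.exp (-‖a‖ ^ 2) := by
    refine Integrable.of_integral_ne_zero ?_
    have := GaussianFourier.integral_rexp_neg_mul_sq_norm (V := ℂ) one_pos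
    simp only [neg_mul, one_mul] at this
    rw [this]
    have := Real.pi_pos
    positivity
  rw [← ofReal_integral_eq_lintegral_ofReal hint.integrableOn
    (Filter.Eventually.of_forall fun v => (Real.exp_pos _).le), ← integral_indicator hm]
  congr 1
  have h := integral_fun_norm_addHaar (volume : Measure ℂ)
    ((Set.Ici (Real.sqrt t)).indicator fun y => Real.exp (-y ^ 2))
  have hind : ∀ a : ℂ, {a : ℂ | t ≤ ‖a‖ ^ 2}.indicator (fun a => Real.exp (-‖a‖ ^ 2)) a =
      (Set.Ici (Real.sqrt t)).indicator (fun y => Real.exp (-y ^ 2)) ‖a‖ := by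
    intro a
    simp [Set.indicator_apply, Real.sqrt_le_left (norm_nonneg a)]
  simp_rw [hind]
  have hset : (Set.Ioi 0 ∩ Set.Ici (Real.sqrt t) : Set ℝ) =ᵐ[volume] Set.Ioi (Real.sqrt t) := by
    have := Real.sqrt_nonneg t
    filter_upwards [Measure.ae_ne volume (Real.sqrt t)] with y hy
    refine propext ⟨fun h => lt_of_le_of_ne h.2 hy.symm, fun h => ⟨this.trans_lt h, le_of_lt h⟩⟩
  rw [h, Complex.finrank_real_complex, Measure.real, Complex.volume_ball]
  simp only [smul_eq_mul, Nat.add_one_sub_one, pow_one]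
  have hmul : ∀ y : ℝ, y * (Set.Ici (Real.sqrt t)).indicator (fun y => Real.exp (-y ^ 2)) y =
      (Set.Ici (Real.sqrt t)).indicator (fun y => y * Real.exp (-y ^ 2)) y := fun y => by
    simp [Set.indicator_apply]
  simp_rw [hmul]
  rw [setIntegral_indicator measurableSet_Ici, setIntegral_congr_set hset,
    integral_Ioi_mul_exp_neg_sq (Real.sqrt_nonneg t), Real.sq_sqrt ht]
  simp
  ring

/-- Unitary maps act transitively on unit vectors, also between different spaces. -/
theorem exists_linearIsometryEquiv_apply_eq {E F : Type*} [NormedAddCommGroup E]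
    [InnerProductSpace ℂ E] [FiniteDimensional ℂ E] [NormedAddCommGroup F]
    [InnerProductSpace ℂ F] [FiniteDimensional ℂ F] {n : ℕ}
    (hE : Module.finrank ℂ E = n + 1) (hF : Module.finrank ℂ F = n + 1) {x : E} {y : F}
    (hx : ‖x‖ = 1) (hy : ‖y‖ = 1) : ∃ e : E ≃ₗᵢ[ℂ] F, e x = y := by
  obtain ⟨b, hb⟩ := Orthonormal.exists_orthonormalBasis_extension_of_card_eq (𝕜 := ℂ) (E := E)
    (ι := Fin (n + 1)) (by simpa using hE) (v := fun _ => x) (s := {0})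
    ⟨fun _ => hx, fun i j hij => (hij (Subsingleton.elim _ _)).elim⟩
  obtain ⟨c, hc⟩ := Orthonormal.exists_orthonormalBasis_extension_of_card_eq (𝕜 := ℂ) (E := F)
    (ι := Fin (n + 1)) (by simpa using hF) (v := fun _ => y) (s := {0})
    ⟨fun _ => hy, fun i j hij => (hij (Subsingleton.elim _ _)).elim⟩
  refine ⟨b.equiv c (Equiv.refl _), ?_⟩
  rw [← hb 0 rfl, OrthonormalBasis.equiv_apply_basis, Equiv.refl_apply, hc 0 rfl]

theorem measurePreserving_linearIsometryEquiv_complex {E F : Type*} [NormedAddCommGroup E]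
    [Module ℂ E] [InnerProductSpace ℝ E] [IsScalarTower ℝ ℂ E] [FiniteDimensional ℝ E]
    [MeasurableSpace E]
    [BorelSpace E] [NormedAddCommGroup F] [Module ℂ F] [InnerProductSpace ℝ F]
    [IsScalarTower ℝ ℂ F] [FiniteDimensional ℝ F] [MeasurableSpace F] [BorelSpace F]
    (e : E ≃ₗᵢ[ℂ] F) : MeasurePreserving e :=
  LinearIsometryEquiv.measurePreserving
    { toLinearEquiv := e.toLinearEquiv.restrictScalars ℝ, norm_map' := e.norm_map }

/-- The Gaussian measure of the cone of vectors at angle at most `arcsin r` from the line of a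
unit vector. After a unitary change of coordinates that line is the first factor of
`ℂ × ℂⁿ`, the cone is `(r⁻² - 1) ‖w‖² ≤ |a|²`, and integrating out `a` only sharpens the
Gaussian in `w` to `exp (-r⁻² ‖w‖²)`. -/
theorem lintegral_exp_neg_norm_sq_cone {n : ℕ} {ψ : EuclideanSpace ℂ (Fin (n + 1))}
    (hψ : ‖ψ‖ = 1) {r : ℝ} (hr : 0 < r) (hr1 : r ≤ 1) :
    ∫⁻ z in {z : EuclideanSpace ℂ (Fin (n + 1)) | (1 - r ^ 2) * ‖z‖ ^ 2 ≤ ‖inner ℂ ψ z‖ ^ 2},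
      ENNReal.ofReal (Real.exp (-‖z‖ ^ 2)) = ENNReal.ofReal (Real.pi ^ (n + 1) * r ^ (2 * n)) := by
  have hfin : Module.finrank ℂ (WithLp 2 (ℂ × EuclideanSpace ℂ (Fin n))) = n + 1 := by
    rw [(WithLp.linearEquiv 2 ℂ (ℂ × EuclideanSpace ℂ (Fin n))).finrank_eq]
    simp [add_comm]
  obtain ⟨e, he⟩ := exists_linearIsometryEquiv_apply_eq
    (F := WithLp 2 (ℂ × EuclideanSpace ℂ (Fin n))) (by simp) hfin hψ
    (y := WithLp.toLp 2 (1, 0)) (by simp)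
  have hfst : ∀ z, inner ℂ ψ z = (e z).ofLp.1 := by
    intro z
    rw [← e.inner_map_map, he, WithLp.prod_inner_apply]
    simp
  have hmp := (WithLp.volume_preserving_ofLp ℂ (EuclideanSpace ℂ (Fin n))).comp
    (measurePreserving_linearIsometryEquiv_complex e)
  have hr2 : 0 < r⁻¹ ^ 2 := by positivity
  have hcone : MeasurableSet {p : ℂ × EuclideanSpace ℂ (Fin n) |
      (r⁻¹ ^ 2 - 1) * ‖p.2‖ ^ 2 ≤ ‖p.1‖ ^ 2} := measurableSet_le (by fun_prop) (by fun_prop)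
  have hcone' : MeasurableSet {z : EuclideanSpace ℂ (Fin (n + 1)) |
      (1 - r ^ 2) * ‖z‖ ^ 2 ≤ ‖inner ℂ ψ z‖ ^ 2} := measurableSet_le (by fun_prop) (by fun_prop)
  let G : ℂ × EuclideanSpace ℂ (Fin n) → ENNReal :=
    {p | (r⁻¹ ^ 2 - 1) * ‖p.2‖ ^ 2 ≤ ‖p.1‖ ^ 2}.indicator
      fun p => ENNReal.ofReal (Real.exp (-(‖p.1‖ ^ 2 + ‖p.2‖ ^ 2)))
  have hG : Measurable G := Measurable.indicator (by fun_prop) hcone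
  calc _ = ∫⁻ z, G (e z).ofLp := by
        rw [← lintegral_indicator hcone']
        refine lintegral_congr fun z => ?_
        have hz : ‖z‖ ^ 2 = ‖(e z).ofLp.1‖ ^ 2 + ‖(e z).ofLp.2‖ ^ 2 := by
          rw [← e.norm_map, WithLp.prod_norm_sq_eq_of_L2]
          rfl
        have hiff : (1 - r ^ 2) * ‖z‖ ^ 2 ≤ ‖inner ℂ ψ z‖ ^ 2 ↔
            (r⁻¹ ^ 2 - 1) * ‖(e z).ofLp.2‖ ^ 2 ≤ ‖(e z).ofLp.1‖ ^ 2 := by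
          rw [hfst, hz, ← mul_le_mul_iff_right₀ (show 0 < r ^ 2 by positivity)
              (b := (r⁻¹ ^ 2 - 1) * _), ← mul_assoc, mul_sub, ← mul_pow, mul_inv_cancel₀ hr.ne']
          constructor <;> intro h <;> linarith
        simp only [G, Set.indicator_apply, Set.mem_ofPred_eq, hiff]
        rw [hz]
    _ = ∫⁻ p, G p := hmp.lintegral_comp hG
    _ = ∫⁻ w, ∫⁻ a, G (a, w) := lintegral_prod_symm' _ hG
    _ = ∫⁻ w : EuclideanSpace ℂ (Fin n),
        ENNReal.ofReal Real.pi * ENNReal.ofReal (Real.exp (-r⁻¹ ^ 2 * ‖w‖ ^ 2)) := by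
        refine lintegral_congr fun w => ?_
        have hnn : 0 ≤ (r⁻¹ ^ 2 - 1) * ‖w‖ ^ 2 := by
          have : 1 ≤ r⁻¹ ^ 2 := one_le_pow₀ ((one_le_inv₀ hr).2 hr1)
          have : 0 ≤ r⁻¹ ^ 2 - 1 := by linarith
          positivity
        have hm : MeasurableSet {a : ℂ | (r⁻¹ ^ 2 - 1) * ‖w‖ ^ 2 ≤ ‖a‖ ^ 2} :=
          measurableSet_le (by fun_prop) (by fun_prop)
        have hGw : ∀ a, G (a, w) = ENNReal.ofReal (Real.exp (-‖w‖ ^ 2)) *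
            {a : ℂ | (r⁻¹ ^ 2 - 1) * ‖w‖ ^ 2 ≤ ‖a‖ ^ 2}.indicator
              (fun a => ENNReal.ofReal (Real.exp (-‖a‖ ^ 2))) a := by
          intro a
          simp only [G, Set.indicator_apply, Set.mem_ofPred_eq, mul_ite, mul_zero]
          rw [← ENNReal.ofReal_mul (Real.exp_pos _).le, ← Real.exp_add, neg_add_rev]
        simp_rw [hGw]
        rw [lintegral_const_mul _ (Measurable.indicator (by fun_prop) hm), lintegral_indicator hm,
          lintegral_exp_neg_norm_sq_tail hnn, ← ENNReal.ofReal_mul (Real.exp_pos _).le,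
          ← ENNReal.ofReal_mul Real.pi_pos.le, mul_left_comm, ← Real.exp_add]
        congr 3
        ring
    _ = _ := by
        rw [lintegral_const_mul _ (by fun_prop), lintegral_exp_neg_mul_norm_sq_euclideanSpace hr2,
          ← ENNReal.ofReal_mul Real.pi_pos.le]
        congr 1
        rw [div_pow, inv_pow, inv_pow, div_inv_eq_mul, ← pow_mul]
        ring

/-! ### The invariant measure on pure states -/

/-- The pure state `|ψ⟩⟨ψ|` of a unit vector `ψ`. -/
def PureState.ofUnit {D : ℕ} (ψ : EuclideanSpace ℂ (Fin D)) (hψ : ‖ψ‖ = 1) : PureState D :=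
  ⟨Matrix.vecMulVec ψ.ofLp (star ψ.ofLp), ψ, hψ, rfl⟩

theorem PureState.exists_eq_ofUnit {D : ℕ} (ρ : PureState D) :
    ∃ (ψ : EuclideanSpace ℂ (Fin D)) (hψ : ‖ψ‖ = 1), ρ = PureState.ofUnit ψ hψ := by
  obtain ⟨ψ, hψ, h⟩ := ρ.isPure
  exact ⟨ψ, hψ, PureState.ext h⟩

theorem PureState.dist_ofUnit {D : ℕ} {ψ φ : EuclideanSpace ℂ (Fin D)} (hψ : ‖ψ‖ = 1)
    (hφ : ‖φ‖ = 1) :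
    dist (PureState.ofUnit ψ hψ) (PureState.ofUnit φ hφ) =
      Real.sqrt (1 - ‖inner ℂ ψ φ‖ ^ 2) := by
  have hself : ∀ v : EuclideanSpace ℂ (Fin D), ‖v‖ = 1 → v.ofLp ⬝ᵥ star v.ofLp = 1 := by
    intro v hv
    rw [← EuclideanSpace.inner_eq_star_dotProduct, inner_self_eq_norm_sq_to_K, hv]
    simp
  have htr : ((Matrix.vecMulVec ψ.ofLp (star ψ.ofLp) -
        Matrix.vecMulVec φ.ofLp (star φ.ofLp)).conjTranspose *
      (Matrix.vecMulVec ψ.ofLp (star ψ.ofLp) - Matrix.vecMulVec φ.ofLp (star φ.ofLp))).trace =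
      ((2 * (1 - ‖inner ℂ ψ φ‖ ^ 2) : ℝ) : ℂ) := by
    have h1 : inner ℂ ψ φ = φ.ofLp ⬝ᵥ star ψ.ofLp := EuclideanSpace.inner_eq_star_dotProduct _ _
    have h2 : inner ℂ φ ψ = ψ.ofLp ⬝ᵥ star φ.ofLp := EuclideanSpace.inner_eq_star_dotProduct _ _
    have h3 : inner ℂ φ ψ * inner ℂ ψ φ = (‖inner ℂ ψ φ‖ ^ 2 : ℂ) := by
      rw [← inner_conj_symm φ ψ, RCLike.conj_mul]
      rfl
    simp only [Matrix.conjTranspose_sub, Matrix.conjTranspose_vecMulVec, star_star, Matrix.sub_mul,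
      Matrix.mul_sub, Matrix.vecMulVec_mul_vecMulVec, Matrix.trace_sub, Matrix.trace_vecMulVec,
      dotProduct_smul, dotProduct_comm (star _), hself ψ hψ, hself φ hφ, ← h1, ← h2]
    push_cast
    rw [← h3]
    simp
    ring
  change traceDist _ _ = _
  rw [traceDist, traceNorm_sub_pure (PureState.ofUnit ψ hψ).isPure (PureState.ofUnit φ hφ).isPure]
  change 1 / 2 * Real.sqrt (2 * ((Matrix.vecMulVec ψ.ofLp (star ψ.ofLp) -
        Matrix.vecMulVec φ.ofLp (star φ.ofLp)).conjTranspose *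
      (Matrix.vecMulVec ψ.ofLp (star ψ.ofLp) - Matrix.vecMulVec φ.ofLp (star φ.ofLp))).trace.re) = _
  rw [htr, Complex.ofReal_re, ← mul_assoc, show (2 * 2 : ℝ) = 2 ^ 2 by norm_num,
    Real.sqrt_mul (by norm_num), Real.sqrt_sq (by norm_num)]
  ring

/-- The direction of a nonzero vector; the zero vector is sent to the first basis vector. -/
def unitDirection {n : ℕ} (z : EuclideanSpace ℂ (Fin (n + 1))) : EuclideanSpace ℂ (Fin (n + 1)) :=
  if z = 0 then EuclideanSpace.single 0 1 else ((‖z‖⁻¹ : ℝ) : ℂ) • z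

theorem norm_unitDirection {n : ℕ} (z : EuclideanSpace ℂ (Fin (n + 1))) :
    ‖unitDirection z‖ = 1 := by
  unfold unitDirection
  split_ifs with h
  · simp
  · rw [norm_smul, Complex.norm_real, norm_inv, norm_norm, inv_mul_cancel₀ (norm_ne_zero_iff.2 h)]

theorem measurable_unitDirection {n : ℕ} :
    Measurable (unitDirection : EuclideanSpace ℂ (Fin (n + 1)) → _) :=
  Measurable.ite (measurableSet_singleton 0) measurable_const (by fun_prop)

/-- The pure state on the line of a vector. -/
def stateOfVector {n : ℕ} (z : EuclideanSpace ℂ (Fin (n + 1))) : PureState (n + 1) :=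
  PureState.ofUnit (unitDirection z) (norm_unitDirection z)

theorem stateOfVector_surjective {n : ℕ} :
    Function.Surjective (stateOfVector : EuclideanSpace ℂ (Fin (n + 1)) → _) := by
  intro ρ
  obtain ⟨ψ, hψ, rfl⟩ := ρ.exists_eq_ofUnit
  have h0 : ψ ≠ 0 := fun h => by simp [h] at hψ
  have : unitDirection ψ = ψ := by simp [unitDirection, h0, hψ]
  refine ⟨ψ, ?_⟩
  simp only [stateOfVector, this]

theorem measurable_dist_stateOfVector {n : ℕ} :
    Measurable fun p : EuclideanSpace ℂ (Fin (n + 1)) × EuclideanSpace ℂ (Fin (n + 1)) =>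
      dist (stateOfVector p.1) (stateOfVector p.2) := by
  simp only [stateOfVector, PureState.dist_ofUnit]
  have h1 : Measurable fun p : EuclideanSpace ℂ (Fin (n + 1)) × EuclideanSpace ℂ (Fin (n + 1)) =>
      unitDirection p.1 := measurable_unitDirection.comp measurable_fst
  have h2 : Measurable fun p : EuclideanSpace ℂ (Fin (n + 1)) × EuclideanSpace ℂ (Fin (n + 1)) =>
      unitDirection p.2 := measurable_unitDirection.comp measurable_snd
  exact (measurable_const.sub ((h1.inner h2).norm.pow_const 2)).sqrt

/-- The Gaussian probability measure on `ℂⁿ⁺¹` with density `π⁻⁽ⁿ⁺¹⁾ exp (-‖z‖²)`. -/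
def complexGaussian (n : ℕ) : Measure (EuclideanSpace ℂ (Fin (n + 1))) :=
  (ENNReal.ofReal (Real.pi ^ (n + 1)))⁻¹ •
    volume.withDensity fun z => ENNReal.ofReal (Real.exp (-‖z‖ ^ 2))

theorem complexGaussian_cone {n : ℕ} {ψ : EuclideanSpace ℂ (Fin (n + 1))}
    (hψ : ‖ψ‖ = 1) {r : ℝ} (hr : 0 < r) (hr1 : r ≤ 1) :
    complexGaussian n {z | (1 - r ^ 2) * ‖z‖ ^ 2 ≤ ‖inner ℂ ψ z‖ ^ 2} =
      ENNReal.ofReal (r ^ (2 * n)) := by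
  have hpi : 0 < Real.pi ^ (n + 1) := pow_pos Real.pi_pos _
  rw [complexGaussian, Measure.smul_apply, withDensity_apply _
    (measurableSet_le (by fun_prop) (by fun_prop)), lintegral_exp_neg_norm_sq_cone hψ hr hr1,
    ENNReal.ofReal_mul hpi.le, smul_eq_mul, ← mul_assoc, ENNReal.inv_mul_cancel, one_mul]
  · simpa using hpi
  · exact ENNReal.ofReal_ne_top

instance {n : ℕ} : IsProbabilityMeasure (complexGaussian n) := by
  have h := complexGaussian_cone (n := n) (ψ := EuclideanSpace.single 0 1) (by simp) one_pos le_rfl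
  refine ⟨?_⟩
  convert h using 2
  · ext z
    simp
  · simp

/-- Under the unitarily invariant probability measure on pure states, every ball of radius `r ≤ 1`
has measure `r ^ (2 (D - 1))`. -/
theorem complexGaussian_preimage_closedBall {n : ℕ} (ρ : PureState (n + 1)) {r : ℝ} (hr : 0 < r)
    (hr1 : r ≤ 1) :
    complexGaussian n (stateOfVector ⁻¹' Metric.closedBall ρ r) = ENNReal.ofReal (r ^ (2 * n)) := by
  obtain ⟨ψ, hψ, rfl⟩ := ρ.exists_eq_ofUnit
  rw [← complexGaussian_cone hψ hr hr1]
  refine measure_congr ?_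
  have hae : ∀ᵐ z ∂(complexGaussian n), z ≠ 0 :=
    Measure.ae_smul_measure ((withDensity_absolutelyContinuous _ _).ae_le
      (Measure.ae_ne volume (0 : EuclideanSpace ℂ (Fin (n + 1))))) _
  filter_upwards [hae] with z hz
  refine propext ?_
  change dist _ _ ≤ r ↔ (1 - r ^ 2) * ‖z‖ ^ 2 ≤ ‖inner ℂ ψ z‖ ^ 2
  rw [dist_comm, stateOfVector, PureState.dist_ofUnit, Real.sqrt_le_left hr.le, unitDirection,
    if_neg hz, inner_smul_right, norm_mul, Complex.norm_real, norm_inv, norm_norm]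
  have hz' : 0 < ‖z‖ ^ 2 := by positivity
  rw [sub_le_comm, mul_pow, inv_pow, inv_mul_eq_div, le_div_iff₀ hz']

/-! ### Bounds for the covering number of pure states -/

/-- The greedy construction with `k` steps at radius `(1 - t) δ`, completed by a maximal separated
set with balls of radius `t δ`. -/
theorem coveringNumber_pureState_le {n : ℕ} {δ : ℝ≥0} (hδ0 : 0 < δ) (hδ1 : δ ≤ 1) {t : ℝ}
    (ht0 : 0 < t) (ht : t ≤ 1 / 2) (k : ℕ) :
    ((Metric.coveringNumber δ (Set.univ : Set (PureState (n + 1))) : ℕ∞) : ENNReal) ≤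
      ENNReal.ofReal (k + (1 - ((1 - t) * δ) ^ (2 * n)) ^ k / (t * δ) ^ (2 * n)) := by
  have hδ0' : (0 : ℝ) < δ := hδ0
  have hδ1' : (δ : ℝ) ≤ 1 := hδ1
  have hs : 0 < t * δ := by positivity
  have hr : 0 < (1 - t) * δ := mul_pos (by linarith) hδ0'
  have hr1 : (1 - t) * δ ≤ 1 := by nlinarith
  have hpow : ((1 - t) * δ) ^ (2 * n) ≤ 1 := pow_le_one₀ hr.le hr1
  have h := coveringNumber_le_of_measure_closedBall (μ := complexGaussian n) (δ := δ)
    measurable_dist_stateOfVector stateOfVector_surjective (r := (1 - t) * δ) (s := t * δ)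
    (by linarith) (by nlinarith) (by simpa using pow_pos hs _) ENNReal.ofReal_ne_top
    (fun ρ => complexGaussian_preimage_closedBall ρ hr hr1)
    (fun ρ => complexGaussian_preimage_closedBall ρ hs (by nlinarith)) k
  refine h.trans_eq ?_
  rw [ENNReal.ofReal_add (by positivity)
      (div_nonneg (pow_nonneg (by linarith) _) (pow_pos hs _).le), ENNReal.ofReal_natCast,
    ENNReal.ofReal_div_of_pos (pow_pos hs _), ENNReal.ofReal_pow (sub_nonneg.2 hpow),
    ENNReal.ofReal_sub _ (pow_pos hr _).le, ENNReal.ofReal_one]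

theorem coveringNumber_pureState_ne_top {n : ℕ} {δ : ℝ≥0} (hδ0 : 0 < δ) (hδ1 : δ ≤ 1) :
    Metric.coveringNumber δ (Set.univ : Set (PureState (n + 1))) ≠ ⊤ := by
  have h := coveringNumber_pureState_le (n := n) hδ0 hδ1 one_half_pos le_rfl 0
  intro htop
  rw [htop] at h
  simp at h

theorem one_div_pow_le_coveringNumber_pureState {n N : ℕ} {δ : ℝ≥0} (hδ0 : 0 < δ) (hδ1 : δ ≤ 1)
    (hN : Metric.coveringNumber δ (Set.univ : Set (PureState (n + 1))) = N) :
    (1 / (δ : ℝ)) ^ (2 * n) ≤ N := by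
  have hδ0' : (0 : ℝ) < δ := hδ0
  have h := one_le_coveringNumber_mul (μ := complexGaussian n) (f := stateOfVector) (δ := δ)
    (fun ρ => complexGaussian_preimage_closedBall ρ hδ0' hδ1)
    (coveringNumber_pureState_ne_top hδ0 hδ1)
  rw [hN, ENat.toENNReal_coe, ← ENNReal.ofReal_natCast, ← ENNReal.ofReal_mul (by positivity),
    ENNReal.one_le_ofReal] at h
  rw [one_div_pow, div_le_iff₀ (by positivity)]
  exact h

/-- The real-number form of `coveringNumber_pureState_le`. -/
theorem natCast_coveringNumber_pureState_le {n N : ℕ} {δ : ℝ≥0} (hδ0 : 0 < δ) (hδ1 : δ ≤ 1)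
    (hN : Metric.coveringNumber δ (Set.univ : Set (PureState (n + 1))) = N) {t : ℝ}
    (ht0 : 0 < t) (ht : t ≤ 1 / 2) (k : ℕ) :
    (N : ℝ) ≤ k + (1 - ((1 - t) * δ) ^ (2 * n)) ^ k / (t * δ) ^ (2 * n) := by
  have h := coveringNumber_pureState_le (n := n) hδ0 hδ1 ht0 ht k
  have hδ0' : (0 : ℝ) < δ := hδ0
  have hδ1' : (δ : ℝ) ≤ 1 := hδ1
  have hr : 0 ≤ (1 - t) * δ := mul_nonneg (by linarith) hδ0'.le
  have hpow : ((1 - t) * δ) ^ (2 * n) ≤ 1 := pow_le_one₀ hr (by nlinarith)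
  have hnn : 0 ≤ (1 - ((1 - t) * δ) ^ (2 * n)) ^ k / (t * δ) ^ (2 * n) :=
    div_nonneg (pow_nonneg (by linarith) _) (by positivity)
  rw [hN, ENat.toENNReal_coe, ← ENNReal.ofReal_natCast,
    ENNReal.ofReal_le_ofReal_iff (by positivity)] at h
  exact h

/-- The bound from a maximal `δ`-separated set alone. -/
theorem coveringNumber_pureState_le_four_pow {n N : ℕ} {δ : ℝ≥0} (hδ0 : 0 < δ) (hδ1 : δ ≤ 1)
    (hN : Metric.coveringNumber δ (Set.univ : Set (PureState (n + 1))) = N) :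
    (N : ℝ) ≤ 4 ^ n * (1 / (δ : ℝ)) ^ (2 * n) := by
  have h := natCast_coveringNumber_pureState_le hδ0 hδ1 hN one_half_pos le_rfl 0
  refine h.trans_eq ?_
  rw [Nat.cast_zero, pow_zero, zero_add, mul_pow, one_div_pow, one_div_pow, pow_mul 2 2 n]
  norm_num
  ring

/-- With `k = ⌈c δ⁻²ⁿ⌉` greedy steps at radius `(1 - t) δ`, the uncovered part has measure at most
`exp (-c (1 - t)²ⁿ)`. -/
theorem coveringNumber_pureState_le_mul {n N : ℕ} {δ : ℝ≥0} (hδ0 : 0 < δ) (hδ1 : δ ≤ 1)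
    (hN : Metric.coveringNumber δ (Set.univ : Set (PureState (n + 1))) = N) {t c : ℝ}
    (ht0 : 0 < t) (ht : t ≤ 1 / 2) (hc : 0 ≤ c) :
    (N : ℝ) ≤ (c + 1 + Real.exp (-(c * (1 - t) ^ (2 * n))) / t ^ (2 * n)) *
      (1 / (δ : ℝ)) ^ (2 * n) := by
  have hδ0' : (0 : ℝ) < δ := hδ0
  have hδ1' : (δ : ℝ) ≤ 1 := hδ1
  set V := (1 / (δ : ℝ)) ^ (2 * n) with hV
  have hV1 : 1 ≤ V := one_le_pow₀ ((one_le_div hδ0').2 hδ1')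
  have hVδ : (δ : ℝ) ^ (2 * n) * V = 1 := by
    rw [hV, ← mul_pow, mul_one_div_cancel hδ0'.ne', one_pow]
  set k := ⌈c * V⌉₊
  have hk : c * V ≤ k := Nat.le_ceil _
  have hk' : (k : ℝ) < c * V + 1 := Nat.ceil_lt_add_one (by positivity)
  have h := natCast_coveringNumber_pureState_le hδ0 hδ1 hN ht0 ht k
  set q := (1 - t) ^ (2 * n) with hq
  have hq0 : 0 ≤ q := pow_nonneg (by linarith) _
  have hb1 : q * (δ : ℝ) ^ (2 * n) ≤ 1 := by
    rw [hq, ← mul_pow]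
    exact pow_le_one₀ (mul_nonneg (by linarith) hδ0'.le) (by nlinarith)
  have hexp : (1 - q * (δ : ℝ) ^ (2 * n)) ^ k ≤ Real.exp (-(c * q)) := by
    calc (1 - q * (δ : ℝ) ^ (2 * n)) ^ k ≤ Real.exp (-(q * (δ : ℝ) ^ (2 * n))) ^ k :=
          pow_le_pow_left₀ (by linarith) (Real.one_sub_le_exp_neg _) _
      _ = Real.exp (-(q * (δ : ℝ) ^ (2 * n) * k)) := by
          rw [← Real.exp_nat_mul]
          ring_nf
      _ ≤ Real.exp (-(c * q)) := by
          refine Real.exp_le_exp.2 (neg_le_neg ?_)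
          calc c * q = q * (δ : ℝ) ^ (2 * n) * (c * V) := by linear_combination -(c * q) * hVδ
            _ ≤ _ := by gcongr
  have hdiv : (1 - q * (δ : ℝ) ^ (2 * n)) ^ k / (t * δ) ^ (2 * n) ≤
      Real.exp (-(c * q)) / t ^ (2 * n) * V := by
    calc _ ≤ Real.exp (-(c * q)) / (t * δ) ^ (2 * n) := by gcongr
      _ = _ := by
        rw [mul_pow, hV, one_div_pow, div_mul_div_comm, mul_one]
  rw [mul_pow] at h
  linarith

/-- The choice `t = 1 / (8 n)`, for which `(1 - t)²ⁿ ≥ 3 / 4` by Bernoulli's inequality. -/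
theorem coveringNumber_pureState_le_log {n N : ℕ} (hn : 1 ≤ n) {δ : ℝ≥0} (hδ0 : 0 < δ)
    (hδ1 : δ ≤ 1) (hN : Metric.coveringNumber δ (Set.univ : Set (PureState (n + 1))) = N) :
    (N : ℝ) ≤ (8 / 3 * n * Real.log (8 * n - 1) + 7 / 3) * (1 / (δ : ℝ)) ^ (2 * n) := by
  have hn' : (1 : ℝ) ≤ n := by exact_mod_cast hn
  have hlog : 0 ≤ Real.log (8 * n - 1) := Real.log_nonneg (by linarith)
  have ht0 : (0 : ℝ) < 1 / (8 * n) := by positivity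
  have ht : 1 / (8 * n : ℝ) ≤ 1 / 2 := one_div_le_one_div_of_le (by norm_num) (by linarith)
  have hq : 3 / 4 ≤ (1 - 1 / (8 * n : ℝ)) ^ (2 * n) := by
    have := one_add_mul_le_pow (a := -(1 / (8 * n : ℝ))) (by linarith) (2 * n)
    refine le_trans (le_of_eq ?_) this
    push_cast
    field_simp
    norm_num
  have h := coveringNumber_pureState_le_mul hδ0 hδ1 hN ht0 ht
    (c := 8 / 3 * n * Real.log (8 * n - 1)) (by positivity)
  refine h.trans ?_
  gcongr ?_ * _
  -- The exponential cancels the power of `t` up to the factor `(1 - t)⁻²ⁿ ≤ 4 / 3`.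
  have hexp : Real.exp (-(8 / 3 * n * Real.log (8 * n - 1) * (1 - 1 / (8 * n : ℝ)) ^ (2 * n))) ≤
      ((8 * n - 1 : ℝ) ^ (2 * n))⁻¹ := by
    rw [← Real.exp_log (show (0 : ℝ) < ((8 * n - 1 : ℝ) ^ (2 * n))⁻¹ from
      inv_pos.2 (pow_pos (by linarith) _)), Real.log_inv, Real.log_pow]
    refine Real.exp_le_exp.2 (neg_le_neg ?_)
    calc ((2 * n : ℕ) : ℝ) * Real.log (8 * n - 1)
        = 8 / 3 * n * Real.log (8 * n - 1) * (3 / 4) := by push_cast; ring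
      _ ≤ _ := by gcongr
  have hdiv : Real.exp (-(8 / 3 * n * Real.log (8 * n - 1) * (1 - 1 / (8 * n : ℝ)) ^ (2 * n))) /
      (1 / (8 * n)) ^ (2 * n) ≤ 4 / 3 := by
    calc _ ≤ ((8 * n - 1 : ℝ) ^ (2 * n))⁻¹ / (1 / (8 * n : ℝ)) ^ (2 * n) := by gcongr
      _ = ((1 - 1 / (8 * n : ℝ)) ^ (2 * n))⁻¹ := by
        rw [div_eq_mul_inv, ← mul_inv, ← mul_pow]
        congr 2
        field_simp
      _ ≤ (3 / 4)⁻¹ := by gcongr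
      _ = _ := by norm_num
  linarith

/-! ### Numerical estimates -/

theorem log_bound_of_four_le {x : ℝ} (hx : 4 ≤ x) :
    8 / 3 * x * Real.log (8 * x - 1) + 7 / 3 ≤ 5 * (x + 1) * Real.log (x + 1) := by
  have hL1 := Real.log_two_gt_d9
  have hL2 := Real.log_two_lt_d9
  have hx0 : 0 < x := by linarith
  have h4 : Real.log 4 = 2 * Real.log 2 := by
    rw [show (4 : ℝ) = 2 ^ 2 by norm_num, Real.log_pow]
    norm_num
  have h8 : Real.log (8 * x - 1) ≤ 3 * Real.log 2 + Real.log x := by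
    calc Real.log (8 * x - 1) ≤ Real.log (2 ^ 3 * x) :=
          Real.log_le_log (by linarith) (by linarith)
      _ = _ := by
        rw [Real.log_mul (by norm_num) hx0.ne', Real.log_pow]
        norm_num
  have hsucc : (x + 1) * Real.log x + 1 ≤ (x + 1) * Real.log (x + 1) := by
    have h := Real.one_sub_inv_le_log_of_pos (show 0 < (x + 1) / x by positivity)
    rw [Real.log_div (by positivity) hx0.ne', inv_div] at h
    have h' := mul_le_mul_of_nonneg_left h (show 0 ≤ x + 1 by positivity)
    have e : (x + 1) * (1 - x / (x + 1)) = 1 := by field_simp; ring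
    linarith
  have hlog4 : 2 * Real.log 2 ≤ Real.log x := h4 ▸ Real.log_le_log (by norm_num) hx
  -- The tangent of `x log x` at `x = 4`.
  have htangent : x * (2 * Real.log 2) + x - 4 ≤ x * Real.log x := by
    have h := Real.one_sub_inv_le_log_of_pos (show 0 < x / 4 by positivity)
    rw [Real.log_div hx0.ne' (by norm_num), inv_div, h4] at h
    have h' := mul_le_mul_of_nonneg_left h hx0.le
    have e : x * (1 - 4 / x) = x - 4 := by field_simp
    linarith
  have h8' := mul_le_mul_of_nonneg_left h8 hx0.le
  nlinarith

theorem log_bound_three : 8 * Real.log 23 + 7 / 3 ≤ 20 * Real.log 4 := by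
  have h4 : Real.log 4 = 2 * Real.log 2 := by
    rw [show (4 : ℝ) = 2 ^ 2 by norm_num, Real.log_pow]
    norm_num
  -- `23 ^ 2 = 529` is slightly above `2 ^ 9`.
  have h : 2 * Real.log 23 = 9 * Real.log 2 + Real.log (529 / 512) := by
    rw [show (529 / 512 : ℝ) = 23 ^ 2 / 2 ^ 9 by norm_num, Real.log_div (by norm_num) (by norm_num),
      Real.log_pow, Real.log_pow]
    norm_num
  have h' := Real.log_le_sub_one_of_pos (show (0 : ℝ) < 529 / 512 by norm_num)
  have := Real.log_two_gt_d9
  linarith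

theorem sixteen_le_fifteen_mul_log_three : 16 ≤ 15 * Real.log 3 := by
  -- `3 ^ 5 = 243` is slightly below `2 ^ 8`.
  have h : 5 * Real.log 3 = 8 * Real.log 2 + Real.log (243 / 256) := by
    rw [show (243 / 256 : ℝ) = 3 ^ 5 / 2 ^ 8 by norm_num, Real.log_div (by norm_num) (by norm_num),
      Real.log_pow, Real.log_pow]
    norm_num
  have h' := Real.one_sub_inv_le_log_of_pos (show (0 : ℝ) < 243 / 256 by norm_num)
  have := Real.log_two_gt_d9
  linarith

end

theorem lemmaA1 (D : ℕ) (hD : 2 ≤ D) (δ : ℝ≥0) (hδ0 : 0 < δ) (hδ1 : δ ≤ 1) :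
    ∃ N : ℕ, Metric.coveringNumber δ (Set.univ : Set (PureState D)) = (N : ℕ∞) ∧
      (1 / (δ : ℝ)) ^ (2 * (D - 1)) ≤ (N : ℝ) ∧
      (N : ℝ) ≤ 5 * (D : ℝ) * Real.log (D : ℝ) * (1 / (δ : ℝ)) ^ (2 * (D - 1)) := by
  obtain ⟨n, rfl⟩ : ∃ n, D = n + 1 := ⟨D - 1, by omega⟩
  obtain ⟨N, hN⟩ := ENat.ne_top_iff_exists.1 (coveringNumber_pureState_ne_top (n := n) hδ0 hδ1)
  have hN := hN.symm
  rw [Nat.add_sub_cancel]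
  refine ⟨N, hN, one_div_pow_le_coveringNumber_pureState hδ0 hδ1 hN, ?_⟩
  have hlow := coveringNumber_pureState_le_four_pow hδ0 hδ1 hN
  have hhigh := coveringNumber_pureState_le_log (by omega) hδ0 hδ1 hN
  obtain rfl | rfl | rfl | hn : n = 1 ∨ n = 2 ∨ n = 3 ∨ 4 ≤ n := by omega
  · refine hlow.trans ?_
    gcongr ?_ * _
    have := Real.log_two_gt_d9
    norm_num
    linarith
  · refine hlow.trans ?_
    gcongr ?_ * _
    have := sixteen_le_fifteen_mul_log_three
    norm_num at this ⊢
    linarith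
  · refine hhigh.trans ?_
    gcongr ?_ * _
    have := log_bound_three
    norm_num at this ⊢
    linarith
  · refine hhigh.trans ?_
    gcongr ?_ * _
    have := log_bound_of_four_le (x := n) (by exact_mod_cast hn)
    push_cast
    exact this
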